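/- For $\mathbb K\in\{\mathbb R,\mathbb C\}$, a Hilbert space $E$ over $\mathbb K$ and $k\ge 1$, let $\otimes^{k,s}E$ be the space of symmetric tensors in the algebraic tensor power $\otimes^k E$, put $$x_1\vee\cdots\vee x_k=\frac1{k!}\sum_{\sigma}x_{\sigma(1)}\otimes\cdots\otimes x_{\sigma(k)}\in\otimes^{k,s}E ,$$ the sum being over all permutations $\sigma$ of $\{1,\dots,k\}$, and let $$\pi_s(z,\otimes^{k,s}E)=\inf\Big\{\sum_{j=1}^n|\lambda_j|\,\|w_j\|^k:\ n\in\mathbb N,\ \lambda_j\in\mathbb K,\ w_j\in E,\ z=\sum_{j=1}^n\lambda_j\,w_j\otimes\cdots\otimes w_j\Big\}$$ be the symmetric projective tensor norm of $z\in\otimes^{k,s}E$. Let $\mathcal H$ be a real Hilbert space and let $\widetilde{\mathcal H}$ be a complexification of $\mathcal H$, that is, a complex Hilbert space $\widetilde{\mathcal H}=\mathcal H\oplus i\mathcal H$ whose norm extends the norm of $\mathcal H$ and satisfies $\|x-iy\|=\|x+iy\|$ for all $x,y\in\mathcal H$. Let $k\ge 3$ and let $x_1,\dots,x_k\in\mathcal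 H$ be nonzero vectors with $$\dim_{\mathbb R}\big(\operatorname{span}_{\mathbb R}\{x_1,\dots,x_k\}\big)=2 .$$ Then $$\pi_s(x_1\vee\cdots\vee x_k,\otimes^{k,s}\mathcal H)>\pi_s(x_1\vee\cdots\vee x_k,\otimes^{k,s}\widetilde{\mathcal H}).$$ -/

import Mathlib

open scoped TensorProduct

noncomputable section

namespace SymTensor

variable (𝕜 : Type*) [RCLike 𝕜] {E : Type*} [NormedAddCommGroup E] [NormedSpace 𝕜 E] {k : ℕ}

/-- The symmetrization map on the algebraic tensor power `E ⊗ ⋯ ⊗ E` (`k` factors):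
`x₁ ⊗ ⋯ ⊗ xₖ ↦ (1 / k!) ∑_σ x_{σ(1)} ⊗ ⋯ ⊗ x_{σ(k)}`. -/
def symmetrization (k : ℕ) (E : Type*) [NormedAddCommGroup E] [NormedSpace 𝕜 E] :
    (⨂[𝕜] _ : Fin k, E) →ₗ[𝕜] (⨂[𝕜] _ : Fin k, E) :=
  ((k.factorial : 𝕜)⁻¹) •
    ∑ σ : Equiv.Perm (Fin k), (PiTensorProduct.reindex 𝕜 (fun _ : Fin k => E) σ).toLinearMap

theorem symmetrization_tprod (x : Fin k → E) :
    symmetrization 𝕜 k E (PiTensorProduct.tprod 𝕜 x) =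
      ((k.factorial : 𝕜)⁻¹) •
        ∑ σ : Equiv.Perm (Fin k), PiTensorProduct.tprod 𝕜 (fun i => x (σ i)) := by
  simp only [symmetrization, LinearMap.smul_apply, LinearMap.sum_apply, LinearEquiv.coe_coe,
    PiTensorProduct.reindex_tprod]
  congr 1
  exact Fintype.sum_equiv (Equiv.inv (Equiv.Perm (Fin k))) _ _ (fun σ => rfl)

/-- The `k`-th symmetric tensor power `⊗^{k,s} E`: the space of symmetric tensors,
i.e. the range of the symmetrization map. -/
def SymPower (k : ℕ) (E : Type*) [NormedAddCommGroup E] [NormedSpace 𝕜 E] :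
    Submodule 𝕜 (⨂[𝕜] _ : Fin k, E) :=
  LinearMap.range (symmetrization 𝕜 k E)

/-- The symmetric tensor `x₁ ∨ ⋯ ∨ xₖ`, the symmetrization of `x₁ ⊗ ⋯ ⊗ xₖ`. -/
def vee (x : Fin k → E) : SymPower 𝕜 k E :=
  ⟨symmetrization 𝕜 k E (PiTensorProduct.tprod 𝕜 x), LinearMap.mem_range_self _ _⟩

/-- The symmetric projective tensor norm `π_s(z, ⊗^{k,s} E)`: the infimum of
`∑ⱼ |λⱼ| ‖wⱼ‖ ^ k` over all representations `z = ∑ⱼ λⱼ (wⱼ ⊗ ⋯ ⊗ wⱼ)` as a finite sum.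
By polarization every symmetric tensor has such a representation. -/
def symProjNorm (z : SymPower 𝕜 k E) : ℝ :=
  sInf {c : ℝ | ∃ (n : ℕ) (lam : Fin n → 𝕜) (w : Fin n → E),
    (z : ⨂[𝕜] _ : Fin k, E) = ∑ j, lam j • PiTensorProduct.tprod 𝕜 (fun _ : Fin k => w j) ∧
    c = ∑ j, ‖lam j‖ * ‖w j‖ ^ k}

end SymTensor

/-- `ι` exhibits the complex Hilbert space `Ht` as a complexification of the real Hilbert space
`H`: `Ht = H ⊕ i H` (identifying `H` with its image), the norm of `Ht` extends the norm of `H`,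
and conjugation `x + i y ↦ x - i y` preserves the norm. -/
structure IsHilbertComplexification {H : Type*} [NormedAddCommGroup H] [InnerProductSpace ℝ H]
    {Ht : Type*} [NormedAddCommGroup Ht] [InnerProductSpace ℂ Ht] (ι : H →ₗ[ℝ] Ht) : Prop where
  existsUnique_re_im : ∀ z : Ht, ∃! p : H × H, z = ι p.1 + Complex.I • ι p.2
  norm_map : ∀ x : H, ‖ι x‖ = ‖x‖
  norm_conj : ∀ x y : H, ‖ι x - Complex.I • ι y‖ = ‖ι x + Complex.I • ι y‖

end


/-!
The real norm is at least `∏ ‖xᵢ‖`: identify the plane spanned by the `xᵢ` isometrically with `ℂ`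
and pair `x₁ ∨ ⋯ ∨ xₖ` with the symmetric map `v ↦ ∏ P vᵢ`, where `P` is the orthogonal projection
onto the plane.

The complex norm is strictly smaller. By Hahn–Banach it is the value at `(x₁, …, xₖ)` of a symmetric
complex form `G` with `‖G (w, …, w)‖ ≤ ‖w‖ ^ k`. By Banach's theorem on symmetric forms, which
holds in the plane by the rigidity below, `Re G` restricted to the plane is bounded by `∏ ‖vᵢ‖`. If
the bound were attained at the `xᵢ`, which are not all parallel, then `Re G` would be
`v ↦ Re (c ∏ vᵢ)` with `‖c‖ = 1`: a symmetric form on the plane attaining its norm at vectors that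
are not all parallel has this shape. Choose `ζ` with `c ζ ^ k = 1` and let `a` and `b` be the
vectors of the plane corresponding to `ζ` and `i ζ`. Expanding `G` at `a ± i b`, vectors of norm
`√2`, gives values whose real parts add up to `2 ^ k`, whereas the bound on the diagonal allows at
most `2 · 2 ^ (k / 2)`. This is impossible for `k ≥ 3`.
-/

noncomputable section

namespace SymTensor

section Symmetric

variable {R ι V W : Type*}

/-- A multilinear map in variables from a single module is symmetric if permuting its arguments
does not change its values. -/
def IsSymmetric [CommSemiring R] [AddCommMonoid V] [Module R V] [AddCommMonoid W] [Module R W]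
    (M : MultilinearMap R (fun _ : ι => V) W) : Prop :=
  ∀ (σ : Equiv.Perm ι) (v : ι → V), M (v ∘ σ) = M v

theorem map_const_add_smul [CommSemiring R] [AddCommMonoid V] [Module R V] [AddCommMonoid W]
    [Module R W] [Fintype ι] [DecidableEq ι] (M : MultilinearMap R (fun _ : ι => V) W) (a b : V)
    (t : R) :
    (M fun _ => a + t • b) =
      ∑ s : Finset ι, t ^ s.card • M (s.piecewise (fun _ => b) fun _ => a) := by
  have hsplit : (fun _ : ι => a + t • b) = (fun _ => t • b) + fun _ => a :=
    funext fun _ => add_comm _ _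
  rw [hsplit, MultilinearMap.map_add_univ]
  refine Finset.sum_congr rfl fun s _ => ?_
  rw [← Finset.prod_const, ← MultilinearMap.map_piecewise_smul]
  congr 1
  funext i
  by_cases hi : i ∈ s <;> simp [hi]

theorem sum_neg_one_pow_card_smul_map_const_sum_compl [CommSemiring R] [AddCommMonoid V]
    [Module R V] [AddCommGroup W] [Module R W] [Fintype ι] [DecidableEq ι]
    (M : MultilinearMap R (fun _ : ι => V) W) (x : ι → V) :
    ∑ t : Finset ι, (-1 : ℤ) ^ t.card • M (fun _ => ∑ i ∈ tᶜ, x i) =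
      ∑ σ : Equiv.Perm ι, M (x ∘ σ) := by
  have hexpand : ∀ t : Finset ι, (-1 : ℤ) ^ t.card • M (fun _ => ∑ i ∈ tᶜ, x i) =
      ∑ r ∈ Fintype.piFinset fun _ : ι => tᶜ, (-1 : ℤ) ^ t.card • M (x ∘ r) := fun t => by
    rw [MultilinearMap.map_sum_finset, Finset.smul_sum]
    rfl
  have hsigns : ∀ r : ι → ι,
      ∑ t ∈ (Finset.univ.image r)ᶜ.powerset, (-1 : ℤ) ^ t.card • M (x ∘ r) =
        if Function.Surjective r then M (x ∘ r) else 0 := fun r => by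
    rw [← Finset.sum_smul, Finset.sum_powerset_neg_one_pow_card, ite_smul, one_smul, zero_smul]
    exact if_congr (by simp [Finset.eq_univ_iff_forall, Function.Surjective]) rfl rfl
  -- Inclusion–exclusion over the indices missed by `r`.
  calc _ = ∑ r : ι → ι, ∑ t ∈ (Finset.univ.image r)ᶜ.powerset,
        (-1 : ℤ) ^ t.card • M (x ∘ r) := by
        simp only [hexpand]
        refine Finset.sum_comm' fun t r => ?_
        grind [Finset.mem_compl]
    _ = ∑ r : ι → ι, if Function.Surjective r then M (x ∘ r) else 0 :=
        Finset.sum_congr rfl fun r _ => hsigns r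
    _ = ∑ σ : Equiv.Perm ι, M (x ∘ σ) := by
        refine (Fintype.sum_of_injective (fun σ : Equiv.Perm ι => (σ : ι → ι))
          DFunLike.coe_injective _ _ (fun r hr => if_neg fun hsurj => hr ?_) fun σ => ?_).symm
        · exact ⟨Equiv.ofBijective r (Finite.surjective_iff_bijective.mp hsurj), rfl⟩
        · exact (if_pos σ.surjective).symm

variable [CommSemiring R] [AddCommMonoid V] [Module R V] [AddCommMonoid W] [Module R W] {n : ℕ}

theorem IsSymmetric.curryLeft {M : MultilinearMap R (fun _ : Fin (n + 1) => V) W}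
    (hM : IsSymmetric M) (a : V) : IsSymmetric (M.curryLeft a) := fun σ v => by
  rw [M.curryLeft_apply, M.curryLeft_apply,
    ← hM (Equiv.Perm.decomposeFin.symm (0, σ)) (Fin.cons a v)]
  congr 1
  funext i
  cases i using Fin.cases <;> simp

theorem IsSymmetric.apply_cons_cons_comm {M : MultilinearMap R (fun _ : Fin (n + 2) => V) W}
    (hM : IsSymmetric M) (a b : V) (v : Fin n → V) :
    M (Fin.cons a (Fin.cons b v : Fin (n + 1) → V)) =
      M (Fin.cons b (Fin.cons a v : Fin (n + 1) → V)) := by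
  rw [← hM (Equiv.swap 0 1)]
  congr 1
  funext i
  refine Fin.cases ?_ (Fin.cases ?_ fun i => ?_) i
  · rw [Function.comp_apply, Equiv.swap_apply_left]
    rfl
  · rw [Function.comp_apply, Fin.succ_zero_eq_one, Equiv.swap_apply_right]
    rfl
  · rw [Function.comp_apply,
      Equiv.swap_apply_of_ne_of_ne (Fin.succ_ne_zero _) (by simp [Fin.ext_iff])]
    rfl

end Symmetric

section SymProjNorm

variable {𝕜 : Type*} [RCLike 𝕜] {k : ℕ} {E : Type*} [NormedAddCommGroup E] [NormedSpace 𝕜 E]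

variable (𝕜) in
/-- The costs `∑ⱼ |λⱼ| ‖wⱼ‖ ^ k` of the representations of a symmetric tensor `z` as a combination
of powers, so that `symProjNorm 𝕜 z` is the infimum of `costs 𝕜 z`. -/
def costs (z : SymPower 𝕜 k E) : Set ℝ :=
  {c : ℝ | ∃ (n : ℕ) (lam : Fin n → 𝕜) (w : Fin n → E),
    (z : ⨂[𝕜] _ : Fin k, E) = ∑ j, lam j • PiTensorProduct.tprod 𝕜 (fun _ : Fin k => w j) ∧
    c = ∑ j, ‖lam j‖ * ‖w j‖ ^ k}

theorem sum_mem_costs {α : Type*} [Fintype α] {z : SymPower 𝕜 k E} (lam : α → 𝕜) (w : α → E)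
    (hz : (z : ⨂[𝕜] _ : Fin k, E) = ∑ j, lam j • PiTensorProduct.tprod 𝕜 fun _ => w j) :
    ∑ j, ‖lam j‖ * ‖w j‖ ^ k ∈ costs 𝕜 z := by
  let e := (Fintype.equivFin α).symm
  refine ⟨Fintype.card α, lam ∘ e, w ∘ e, hz.trans ?_, ?_⟩
  all_goals exact (Fintype.sum_equiv e _ _ fun _ => rfl).symm

theorem zero_mem_costs : (0 : ℝ) ∈ costs 𝕜 (0 : SymPower 𝕜 k E) :=
  ⟨0, Fin.elim0, Fin.elim0, by simp, by simp⟩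

theorem add_mem_costs {y z : SymPower 𝕜 k E} {a b : ℝ} (ha : a ∈ costs 𝕜 y)
    (hb : b ∈ costs 𝕜 z) : a + b ∈ costs 𝕜 (y + z) := by
  obtain ⟨n, lam, w, hy, rfl⟩ := ha
  obtain ⟨m, lam', w', hz, rfl⟩ := hb
  simpa using sum_mem_costs (z := y + z) (Sum.elim lam lam') (Sum.elim w w') (by simp [hy, hz])

theorem smul_mem_costs {z : SymPower 𝕜 k E} {a : ℝ} (c : 𝕜) (ha : a ∈ costs 𝕜 z) :
    ‖c‖ * a ∈ costs 𝕜 (c • z) := by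
  obtain ⟨n, lam, w, hz, rfl⟩ := ha
  refine ⟨n, fun j => c * lam j, w, ?_, ?_⟩
  · simp [hz, Finset.smul_sum, smul_smul]
  · simp [Finset.mul_sum, mul_assoc]

theorem nonneg_of_mem_costs {z : SymPower 𝕜 k E} {a : ℝ} (ha : a ∈ costs 𝕜 z) : 0 ≤ a := by
  obtain ⟨n, lam, w, -, rfl⟩ := ha
  positivity

theorem bddBelow_costs (z : SymPower 𝕜 k E) : BddBelow (costs 𝕜 z) :=
  ⟨0, fun _ => nonneg_of_mem_costs⟩

theorem symPower_le_span_tprod_const :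
    SymPower 𝕜 k E ≤
      Submodule.span 𝕜 (Set.range fun w : E => PiTensorProduct.tprod 𝕜 fun _ : Fin k => w) := by
  rw [SymPower, ← Submodule.map_top, ← PiTensorProduct.span_tprod_eq_top, Submodule.map_span_le]
  rintro _ ⟨x, rfl⟩
  have hpol := sum_neg_one_pow_card_smul_map_const_sum_compl (PiTensorProduct.tprod 𝕜) x
  simp only [Function.comp_def] at hpol
  rw [symmetrization_tprod, ← hpol]
  exact Submodule.smul_mem _ _ (Submodule.sum_mem _ fun t _ =>
    zsmul_mem (Submodule.subset_span (Set.mem_range_self _)) _)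

theorem costs_nonempty (z : SymPower 𝕜 k E) : (costs 𝕜 z).Nonempty := by
  obtain ⟨n, lam, t, hz⟩ := Submodule.mem_span_set'.mp (symPower_le_span_tprod_const z.2)
  choose w hw using fun j => (t j).2
  exact ⟨_, n, lam, w, by simp only [← hz, ← hw], rfl⟩

theorem symProjNorm_add_le (y z : SymPower 𝕜 k E) :
    symProjNorm 𝕜 (y + z) ≤ symProjNorm 𝕜 y + symProjNorm 𝕜 z := by
  refine (csInf_le_csInf (bddBelow_costs _) ((costs_nonempty y).add (costs_nonempty z)) ?_).trans_eq
    (csInf_add (costs_nonempty y) (bddBelow_costs y) (costs_nonempty z) (bddBelow_costs z))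
  exact Set.add_subset_iff.mpr fun a ha b hb => add_mem_costs ha hb

theorem symProjNorm_smul_le (c : 𝕜) (z : SymPower 𝕜 k E) :
    symProjNorm 𝕜 (c • z) ≤ ‖c‖ * symProjNorm 𝕜 z := by
  refine (csInf_le_csInf (bddBelow_costs _) (costs_nonempty z).smul_set ?_).trans_eq
    (Real.sInf_smul_of_nonneg (norm_nonneg c) (costs 𝕜 z))
  rintro _ ⟨a, ha, rfl⟩
  exact smul_mem_costs c ha

variable (𝕜 k E) in
/-- The symmetric projective tensor norm as a bundled seminorm, the form in which Mathlib's
Hahn–Banach theorem applies to it. -/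
def symProjSeminorm : Seminorm 𝕜 (SymPower 𝕜 k E) :=
  Seminorm.ofSMulLE (symProjNorm 𝕜)
    (le_antisymm (csInf_le (bddBelow_costs _) zero_mem_costs)
      (Real.sInf_nonneg fun _ => nonneg_of_mem_costs))
    symProjNorm_add_le symProjNorm_smul_le

variable (𝕜 k E) in
/-- The symmetric product `x ↦ x₁ ∨ ⋯ ∨ xₖ` as a multilinear map. -/
def veeMultilinear : MultilinearMap 𝕜 (fun _ : Fin k => E) (SymPower 𝕜 k E) :=
  (symmetrization 𝕜 k E).rangeRestrict.compMultilinearMap (PiTensorProduct.tprod 𝕜)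

theorem vee_comp_perm (x : Fin k → E) (σ : Equiv.Perm (Fin k)) :
    vee 𝕜 (x ∘ σ) = vee 𝕜 x := by
  refine Subtype.ext ?_
  simp only [vee, symmetrization_tprod]
  congr 1
  exact Fintype.sum_equiv (Equiv.mulLeft σ) _ _ fun _ => rfl

theorem lift_vee_of_isSymmetric {F : Type*} [AddCommGroup F] [Module 𝕜 F]
    {f : MultilinearMap 𝕜 (fun _ : Fin k => E) F} (hf : IsSymmetric f) (x : Fin k → E) :
    PiTensorProduct.lift f (vee 𝕜 x : ⨂[𝕜] _ : Fin k, E) = f x := by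
  have hfact : (k.factorial : 𝕜) ≠ 0 := by exact_mod_cast k.factorial_ne_zero
  have hperm : ∀ σ : Equiv.Perm (Fin k), f (fun i => x (σ i)) = f x := fun σ => hf σ x
  simp only [vee, symmetrization_tprod, map_smul, map_sum, PiTensorProduct.lift.tprod, hperm,
    Finset.sum_const, Finset.card_univ, Fintype.card_perm, Fintype.card_fin]
  rw [← Nat.cast_smul_eq_nsmul 𝕜, inv_smul_smul₀ hfact]

theorem norm_apply_le_symProjNorm_vee {F : Type*} [SeminormedAddCommGroup F] [NormedSpace 𝕜 F]
    {f : MultilinearMap 𝕜 (fun _ : Fin k => E) F} (hf : IsSymmetric f)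
    (hdiag : ∀ w, ‖f fun _ => w‖ ≤ ‖w‖ ^ k) (x : Fin k → E) :
    ‖f x‖ ≤ symProjNorm 𝕜 (vee 𝕜 x) := by
  refine le_csInf (costs_nonempty _) ?_
  rintro _ ⟨n, lam, w, hx, rfl⟩
  rw [← lift_vee_of_isSymmetric hf, hx, map_sum]
  refine (norm_sum_le _ _).trans (Finset.sum_le_sum fun j _ => ?_)
  rw [map_smul, PiTensorProduct.lift.tprod, norm_smul]
  gcongr
  exact hdiag _

theorem symProjNorm_vee_const_le (w : E) :
    symProjNorm 𝕜 (vee 𝕜 fun _ : Fin k => w) ≤ ‖w‖ ^ k := by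
  have hfact : (k.factorial : 𝕜) ≠ 0 := by exact_mod_cast k.factorial_ne_zero
  refine csInf_le (bddBelow_costs _) ⟨1, fun _ => 1, fun _ => w, ?_, by simp⟩
  simp only [vee, symmetrization_tprod, Finset.sum_const, Finset.card_univ, Fintype.card_perm,
    Fintype.card_fin]
  rw [← Nat.cast_smul_eq_nsmul 𝕜, inv_smul_smul₀ hfact]
  simp

theorem exists_dual_apply_eq_seminorm {V : Type*} [AddCommGroup V] [Module 𝕜 V]
    (p : Seminorm 𝕜 V) (z : V) :
    ∃ g : Module.Dual 𝕜 V, g z = (p z : 𝕜) ∧ ∀ y, ‖g y‖ ≤ p y := by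
  let := p.toAddGroupSeminorm.toSeminormedAddCommGroup
  let : NormedSpace 𝕜 V := ⟨fun c y => (map_smul_eq_mul p c y).le⟩
  obtain ⟨g, hg, hgz⟩ := exists_dual_vector'' 𝕜 z
  exact ⟨g, hgz, fun y => (g.le_of_opNorm_le hg y).trans_eq (one_mul _)⟩

theorem exists_isSymmetric_apply_eq_symProjNorm_vee (x : Fin k → E) :
    ∃ G : MultilinearMap 𝕜 (fun _ : Fin k => E) 𝕜, IsSymmetric G ∧
      (∀ w, ‖G fun _ => w‖ ≤ ‖w‖ ^ k) ∧ G x = (symProjNorm 𝕜 (vee 𝕜 x) : 𝕜) := by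
  obtain ⟨g, hgx, hg⟩ := exists_dual_apply_eq_seminorm (symProjSeminorm 𝕜 k E) (vee 𝕜 x)
  exact ⟨g.compMultilinearMap (veeMultilinear 𝕜 k E),
    fun σ v => congrArg g (vee_comp_perm v σ),
    fun w => (hg _).trans (symProjNorm_vee_const_le w), hgx⟩

theorem prod_norm_le_symProjNorm_vee {A : Type*} [NormedField A] [NormedAlgebra 𝕜 A]
    (P : E →ₗ[𝕜] A) (hP : ∀ v, ‖P v‖ ≤ ‖v‖) (x : Fin k → E) :
    ∏ i, ‖P (x i)‖ ≤ symProjNorm 𝕜 (vee 𝕜 x) := by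
  let f := (MultilinearMap.mkPiAlgebra 𝕜 (Fin k) A).compLinearMap fun _ => P
  have hf : IsSymmetric f := fun σ v => Equiv.prod_comp σ fun i => P (v i)
  rw [← norm_prod]
  refine norm_apply_le_symProjNorm_vee hf (fun w => ?_) x
  simpa [f] using pow_le_pow_left₀ (norm_nonneg _) (hP w) k

end SymProjNorm

section Plane

/-- The real part of `c` times the complex product, as a real multilinear form on the plane: the
model of the symmetric forms attaining their norm at vectors that are not all parallel. -/
def reForm {ι : Type*} [Fintype ι] (c : ℂ) : MultilinearMap ℝ (fun _ : ι => ℂ) ℝ :=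
  (Complex.reLm ∘ₗ LinearMap.mulLeft ℝ c).compMultilinearMap (MultilinearMap.mkPiAlgebra ℝ ι ℂ)

theorem reForm_apply {ι : Type*} [Fintype ι] (c : ℂ) (v : ι → ℂ) :
    reForm c v = (c * ∏ i, v i).re := rfl

theorem curryLeft_reForm {n : ℕ} (c a : ℂ) :
    (reForm c : MultilinearMap ℝ (fun _ : Fin (n + 1) => ℂ) ℝ).curryLeft a = reForm (c * a) := by
  ext v
  simp only [MultilinearMap.curryLeft_apply, reForm_apply, Fin.prod_univ_succ, Fin.cons_zero,
    Fin.cons_succ, mul_assoc]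

theorem exists_norm_eq_one_and_mul_pow_eq_norm (c : ℂ) {k : ℕ} (hk : k ≠ 0) :
    ∃ ζ : ℂ, ‖ζ‖ = 1 ∧ c * ζ ^ k = ‖c‖ := by
  rcases eq_or_ne c 0 with rfl | hc
  · exact ⟨1, by simp⟩
  obtain ⟨ζ, hζ⟩ := IsAlgClosed.exists_pow_nat_eq (‖c‖ / c : ℂ) (Nat.pos_of_ne_zero hk)
  refine ⟨ζ, ?_, by rw [hζ, mul_div_cancel₀ _ hc]⟩
  rw [← pow_eq_one_iff_of_nonneg (norm_nonneg ζ) hk, ← norm_pow, hζ]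
  simp [hc]

theorem linearIndependent_pair_mul {a z : ℂ} (ha : a ≠ 0) (hz : z.im ≠ 0) :
    LinearIndependent ℝ ![a, a * z] := by
  rw [LinearIndependent.pair_iff' ha]
  intro r hr
  rw [Complex.real_smul, mul_comm, mul_right_inj' ha] at hr
  exact hz (by simp [← hr])

theorem ext_curryLeft {n : ℕ} {M M' : MultilinearMap ℝ (fun _ : Fin (n + 1) => ℂ) ℝ} {a b : ℂ}
    (hab : LinearIndependent ℝ ![a, b]) (ha : M.curryLeft a = M'.curryLeft a)
    (hb : M.curryLeft b = M'.curryLeft b) : M = M' := by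
  have hspan : Submodule.span ℝ (Set.range ![a, b]) = ⊤ :=
    hab.span_eq_top_of_card_eq_finrank (by simp [Complex.finrank_real_complex])
  have hcurry : M.curryLeft = M'.curryLeft :=
    LinearMap.ext_on_range hspan (Fin.forall_fin_two.mpr ⟨ha, hb⟩)
  rw [← M.uncurry_curryLeft, hcurry, M'.uncurry_curryLeft]

theorem apply_eq_re_mul_of_attains {f : ℂ →ₗ[ℝ] ℝ} {c b : ℂ} (hf : ∀ v, f v ≤ ‖c * v‖) (hb : b ≠ 0)
    (hfb : (f b : ℂ) = c * b) (x : ℂ) : f x = (c * x).re := by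
  have hcoord : ∀ w : ℂ, f (b * w) = w.re * f b + w.im * f (b * Complex.I) := fun w => by
    have hw : b * w = w.re • b + w.im • (b * Complex.I) := by
      rw [Complex.real_smul, Complex.real_smul]
      linear_combination b * (Complex.re_add_im w).symm
    rw [hw, map_add, map_smul, map_smul, smul_eq_mul, smul_eq_mul]
  have hortho : f (b * Complex.I) = 0 := by
    -- The vector `b * (N + t * I)` points along the gradient of `f`.
    set N := f b
    set t := f (b * Complex.I)
    set s := ‖(N + t * Complex.I : ℂ)‖ with hs
    have hle : N * N + t * t ≤ |N| * s := by
      simpa [hcoord, ← mul_assoc, ← hfb, ← hs] using hf (b * (N + t * Complex.I))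
    have hsq : s ^ 2 = N ^ 2 + t ^ 2 := by
      rw [← Complex.normSq_eq_norm_sq, Complex.normSq_add_mul_I]
    have hamgm := two_mul_le_add_sq |N| s
    rw [hsq, sq_abs] at hamgm
    nlinarith
  have hx := hcoord (x / b)
  rw [mul_div_cancel₀ _ hb, hortho, mul_zero, add_zero] at hx
  rw [hx, ← Complex.re_mul_ofReal, hfb]
  congr 1
  field_simp

theorem eq_reForm_of_attains_one {M : MultilinearMap ℝ (fun _ : Fin 1 => ℂ) ℝ} {c : ℂ}
    (hle : ∀ v, M v ≤ ‖c * ∏ i, v i‖) {u : Fin 1 → ℂ} (hu : u 0 ≠ 0)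
    (hMu : (M u : ℂ) = c * ∏ i, u i) : M = reForm c := by
  have hval : ∀ v, M.toLinearMap 0 0 (v 0) = M v := fun v =>
    congrArg M (funext fun i => by rw [Subsingleton.elim i 0, Function.update_self])
  ext v
  rw [← hval, reForm_apply, Fin.prod_univ_one]
  refine apply_eq_re_mul_of_attains (fun w => ?_) hu ?_ (v 0)
  · simpa only [Fin.prod_univ_one] using (hval fun _ => w).trans_le (hle _)
  · rw [hval, hMu, Fin.prod_univ_one]

theorem eq_reForm_of_attains_two {M : MultilinearMap ℝ (fun _ : Fin 2 => ℂ) ℝ}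
    (hM : IsSymmetric M) {c : ℂ} (hle : ∀ v, M v ≤ ‖c * ∏ i, v i‖) {u : Fin 2 → ℂ}
    (hu : ∀ i, u i ≠ 0) (hMu : (M u : ℂ) = c * ∏ i, u i) {i j : Fin 2}
    (hij : LinearIndependent ℝ ![u i, u j]) : M = reForm c := by
  have hcurry : ∀ i, M.curryLeft (u i) = (reForm c).curryLeft (u i) := fun i => by
    obtain ⟨w, hw, hMw, hwi⟩ : ∃ w : Fin 2 → ℂ, (∀ i, w i ≠ 0) ∧ (M w : ℂ) = c * ∏ i, w i ∧
        w 0 = u i :=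
      ⟨u ∘ Equiv.swap 0 i, fun _ => hu _,
        by rw [hM, hMu, ← Equiv.prod_comp (Equiv.swap 0 i)]; rfl,
        congrArg u (Equiv.swap_apply_left 0 i)⟩
    rw [curryLeft_reForm, ← hwi]
    refine eq_reForm_of_attains_one (u := Fin.tail w) (fun v => (hle _).trans_eq ?_) (hw _) ?_
    · simp only [Fin.prod_univ_succ, Fin.cons_zero, Fin.cons_succ, mul_assoc]
    · rw [M.curryLeft_apply, Fin.cons_self_tail, hMw, Fin.prod_univ_succ, mul_assoc]
      rfl
  exact ext_curryLeft hij (hcurry i) (hcurry j)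

theorem exists_perm_succ_succ {n : ℕ} (i j : Fin (n + 3)) :
    ∃ (σ : Equiv.Perm (Fin (n + 3))) (p q : Fin (n + 2)), σ p.succ = i ∧ σ q.succ = j := by
  obtain ⟨l, hli, hlj⟩ := Fin.exists_ne_and_ne_of_two_lt i j (by omega)
  have hsucc : ∀ m, l ≠ m → ∃ p : Fin (n + 2), Equiv.swap 0 l p.succ = m := fun m hm => by
    obtain ⟨p, hp⟩ := Fin.exists_succ_eq.mpr
      (fun h0 => hm (by simpa using (congrArg (Equiv.swap 0 l) h0).symm) :
        Equiv.swap 0 l m ≠ 0)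
    exact ⟨p, by rw [hp, Equiv.swap_apply_self]⟩
  obtain ⟨p, hp⟩ := hsucc i hli
  obtain ⟨q, hq⟩ := hsucc j hlj
  exact ⟨Equiv.swap 0 l, p, q, hp, hq⟩

theorem eq_reForm_of_attains {n : ℕ} {M : MultilinearMap ℝ (fun _ : Fin (n + 2) => ℂ) ℝ}
    (hM : IsSymmetric M) {c : ℂ} (hle : ∀ v, M v ≤ ‖c * ∏ i, v i‖) {u : Fin (n + 2) → ℂ}
    (hu : ∀ i, u i ≠ 0) (hMu : (M u : ℂ) = c * ∏ i, u i) {i j : Fin (n + 2)}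
    (hij : LinearIndependent ℝ ![u i, u j]) : M = reForm c := by
  induction n generalizing c with
  | zero => exact eq_reForm_of_attains_two hM hle hu hMu hij
  | succ n ih =>
    obtain ⟨σ, p, q, rfl, rfl⟩ := exists_perm_succ_succ i j
    have hcurry : ∀ (a : ℂ) (v : Fin (n + 2) → ℂ) (p q : Fin (n + 2)), (∀ i, v i ≠ 0) →
        (M (Fin.cons a v) : ℂ) = c * a * ∏ i, v i → LinearIndependent ℝ ![v p, v q] →
        M.curryLeft a = reForm (c * a) := fun a v p q hv hMv hpq => by
      refine ih (hM.curryLeft a) (fun w => (hle _).trans_eq ?_) hv hMv hpq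
      simp only [Fin.prod_univ_succ, Fin.cons_zero, Fin.cons_succ, mul_assoc]
    set w := u ∘ σ
    have hw : ∀ i, w i ≠ 0 := fun i => hu _
    have hMw : (M w : ℂ) = c * ∏ i, w i := by rw [hM σ u, hMu, ← Equiv.prod_comp σ]; rfl
    have hw₀ : M.curryLeft (w 0) = reForm (c * w 0) := by
      refine hcurry (w 0) (Fin.tail w) p q (fun i => hw _) ?_ hij
      rw [Fin.cons_self_tail, hMw, Fin.prod_univ_succ, mul_assoc]
      rfl
    -- The slice at `w 0` makes the tuples `(r ω, w 0, w 0 / ω, 1, …)` extremal for all nonreal `ω`,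
    -- so the induction hypothesis applies to the slices at the vectors `r ω`, which span the plane.
    set r := (∏ i, w i) / w 0 ^ 2 with hr
    have hr₀ : r ≠ 0 := div_ne_zero (Finset.prod_ne_zero_iff.mpr fun i _ => hw i)
      (pow_ne_zero 2 (hw 0))
    have hrotate : ∀ ω : ℂ, ω.im ≠ 0 →
        M.curryLeft (r * ω) = reForm (c * (r * ω)) := fun ω hω => by
      have hω₀ : ω ≠ 0 := by rintro rfl; exact hω rfl
      have hprod : c * (r * ω) * (w 0 * (w 0 / ω)) = M w := by
        rw [hMw, hr]
        field_simp [hw 0]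
      refine hcurry (r * ω) (Fin.cons (w 0) (Fin.cons (w 0 / ω) fun _ => 1)) 0 1
        (Fin.cases (hw 0) (Fin.cases (div_ne_zero (hw 0) hω₀) fun _ => one_ne_zero)) ?_
        (linearIndependent_pair_mul (hw 0) (by simp [hω, hω₀]))
      rw [hM.apply_cons_cons_comm, ← M.curryLeft_apply, hw₀, reForm_apply]
      simp only [Fin.prod_univ_succ, Fin.cons_zero, Fin.cons_succ, Finset.prod_const_one, mul_one]
      rw [hprod, show c * w 0 * (r * ω * (w 0 / ω)) = M w by rw [← hprod]; ring, Complex.ofReal_re]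
    refine ext_curryLeft (linearIndependent_pair_mul (z := 1 + Complex.I)
      (mul_ne_zero hr₀ Complex.I_ne_zero) (by simp)) ?_ ?_
    · rw [hrotate _ (by simp), curryLeft_reForm]
    · rw [mul_assoc, hrotate _ (by simp), curryLeft_reForm]

theorem continuous_multilinearMap_of_finiteDimensional {𝕜 ι V W : Type*}
    [NontriviallyNormedField 𝕜] [CompleteSpace 𝕜] [Finite ι] [AddCommGroup V] [Module 𝕜 V]
    [TopologicalSpace V] [IsTopologicalAddGroup V] [ContinuousSMul 𝕜 V] [T2Space V]
    [FiniteDimensional 𝕜 V] [AddCommGroup W] [Module 𝕜 W] [TopologicalSpace W] [ContinuousAdd W]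
    [ContinuousSMul 𝕜 W] (M : MultilinearMap 𝕜 (fun _ : ι => V) W) : Continuous M := by
  classical
  have := Fintype.ofFinite ι
  let b := Module.finBasis 𝕜 V
  have hexpand : ∀ v : ι → V, M v = ∑ r : ι → Fin (Module.finrank 𝕜 V),
      (∏ i, b.coord (r i) (v i)) • M fun i => b (r i) := fun v => by
    conv_lhs => rw [← funext fun i => b.sum_repr (v i), MultilinearMap.map_sum]
    exact Finset.sum_congr rfl fun r _ => M.map_smul_univ _ _
  have hcoord : ∀ r, Continuous (b.coord r) := fun r =>
    (b.coord r).continuous_of_finiteDimensional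
  rw [funext hexpand]
  fun_prop

theorem exists_forall_le_mul_prod_norm {ι V : Type*} [Fintype ι] [NormedAddCommGroup V]
    [NormedSpace ℝ V] [FiniteDimensional ℝ V] [Nontrivial V]
    (M : MultilinearMap ℝ (fun _ : ι => V) ℝ) :
    ∃ u : ι → V, (∀ i, ‖u i‖ = 1) ∧ ∀ v, M v ≤ M u * ∏ i, ‖v i‖ := by
  have hcompact : IsCompact (Set.univ.pi fun _ : ι => Metric.sphere (0 : V) 1) :=
    isCompact_univ_pi fun _ => isCompact_sphere _ _
  obtain ⟨e, he⟩ := exists_norm_eq V zero_le_one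
  obtain ⟨u, hu, hmax⟩ := hcompact.exists_isMaxOn ⟨fun _ => e, fun i _ => by simpa using he⟩
    (continuous_multilinearMap_of_finiteDimensional M).continuousOn
  refine ⟨u, fun i => by simpa using hu i trivial, fun v => ?_⟩
  by_cases hv : ∃ i, v i = 0
  · obtain ⟨i, hi⟩ := hv
    rw [M.map_coord_zero i hi, Finset.prod_eq_zero (Finset.mem_univ i) (by simp [hi]), mul_zero]
  · push Not at hv
    have hnormalized : M (fun i => ‖v i‖⁻¹ • v i) ≤ M u :=
      hmax fun i _ => by simpa using norm_smul_inv_norm (𝕜 := ℝ) (hv i)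
    rwa [M.map_smul_univ, smul_eq_mul, Finset.prod_inv_distrib, inv_mul_le_iff₀, mul_comm]
      at hnormalized
    exact Finset.prod_pos fun i _ => norm_pos_iff.mpr (hv i)

theorem exists_eq_reForm_of_attains {k : ℕ} {M : MultilinearMap ℝ (fun _ : Fin k => ℂ) ℝ}
    (hM : IsSymmetric M) {N : ℝ} (hle : ∀ v, M v ≤ N * ∏ i, ‖v i‖) {u : Fin k → ℂ}
    (hu : ∀ i, u i ≠ 0) (hMu : M u = N * ∏ i, ‖u i‖) {i j : Fin k}
    (hij : LinearIndependent ℝ ![u i, u j]) : ∃ c : ℂ, ‖c‖ = |N| ∧ M = reForm c := by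
  have hne : i ≠ j := fun h => hij.injective.ne zero_ne_one (congrArg u h)
  obtain ⟨n, rfl⟩ : ∃ n, k = n + 2 := ⟨k - 2, by omega⟩
  have hprod : ∏ i, u i ≠ 0 := Finset.prod_ne_zero_iff.mpr fun i _ => hu i
  have hc : ‖(M u : ℂ) / ∏ i, u i‖ = |N| := by
    rw [norm_div, Complex.norm_real, Real.norm_eq_abs, hMu, abs_mul, norm_prod,
      abs_of_nonneg (a := ∏ i, ‖u i‖) (by positivity)]
    exact mul_div_cancel_right₀ _ (by simpa [← norm_prod] using hprod)
  refine ⟨_, hc, eq_reForm_of_attains hM (fun v => (hle v).trans ?_) hu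
    (div_mul_cancel₀ _ hprod).symm hij⟩
  rw [norm_mul, hc, norm_prod]
  gcongr
  exact le_abs_self N

theorem apply_le_prod_norm {k : ℕ} {M : MultilinearMap ℝ (fun _ : Fin k => ℂ) ℝ}
    (hM : IsSymmetric M) (hdiag : ∀ w, |M fun _ => w| ≤ ‖w‖ ^ k) (v : Fin k → ℂ) :
    M v ≤ ∏ i, ‖v i‖ := by
  obtain ⟨u, hu, hmax⟩ := exists_forall_le_mul_prod_norm M
  have hu₀ : ∀ i, u i ≠ 0 := fun i => norm_pos_iff.mp (by rw [hu]; exact one_pos)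
  suffices |M u| ≤ 1 from
    (hmax v).trans (mul_le_of_le_one_left (by positivity) ((le_abs_self _).trans this))
  by_cases hpair : ∃ i j, LinearIndependent ℝ ![u i, u j]
  · obtain ⟨i, j, hij⟩ := hpair
    obtain ⟨c, hc, rfl⟩ := exists_eq_reForm_of_attains hM hmax hu₀ (by simp [hu]) hij
    obtain ⟨ζ, hζ, hcζ⟩ := exists_norm_eq_one_and_mul_pow_eq_norm c (Fin.pos i).ne'
    simpa [reForm_apply, hcζ, hζ, hc] using hdiag ζ
  · obtain ⟨e, he, hue⟩ : ∃ e : ℂ, ‖e‖ = 1 ∧ ∀ i, ∃ ε : ℝ, ε • e = u i := by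
      rcases isEmpty_or_nonempty (Fin k) with _ | ⟨⟨i⟩⟩
      · exact ⟨1, norm_one, isEmptyElim⟩
      · push Not at hpair
        exact ⟨u i, hu i, fun j => by simpa [LinearIndependent.pair_iff' (hu₀ i)] using hpair i j⟩
    choose ε hε using hue
    have hε₁ : ∀ i, |ε i| = 1 := fun i => by
      rw [← Real.norm_eq_abs, ← mul_one ‖ε i‖, ← he, ← norm_smul, hε, hu, he]
    rw [← funext hε, M.map_smul_univ, smul_eq_mul, abs_mul, Finset.abs_prod]
    simpa [hε₁, he] using hdiag e

end Plane

section Complexification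

theorem I_pow_add_neg_I_pow (n : ℕ) :
    Complex.I ^ n + (-Complex.I) ^ n = (2 * (Complex.I ^ n).re : ℝ) := by
  rw [← Complex.add_conj, map_pow, Complex.conj_I]

theorem two_mul_re_I_pow_sq (n : ℕ) : 2 * (Complex.I ^ n).re ^ 2 = 1 + (-1) ^ n := by
  have hnorm : (Complex.I ^ n).re ^ 2 + (Complex.I ^ n).im ^ 2 = 1 := by
    rw [sq, sq, ← Complex.normSq_apply, map_pow, Complex.normSq_I, one_pow]
  have hsq : (Complex.I ^ n).re ^ 2 - (Complex.I ^ n).im ^ 2 = (-1) ^ n := by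
    have h : (Complex.I ^ n) ^ 2 = ((-1) ^ n : ℝ) := by
      rw [← pow_mul, mul_comm, pow_mul, Complex.I_sq]
      norm_cast
    rw [← Complex.ofReal_re ((-1) ^ n), ← h, sq (Complex.I ^ n), Complex.mul_re, sq, sq]
  linarith

theorem sum_one_add_neg_one_pow_card {α : Type*} [Fintype α] [Nonempty α] :
    ∑ s : Finset α, (1 + (-1 : ℝ) ^ s.card) = 2 ^ Fintype.card α := by
  have hsigns := Fintype.sum_pow_mul_eq_add_pow α (-1 : ℝ) 1
  simp only [one_pow, mul_one, neg_add_cancel, zero_pow Fintype.card_ne_zero] at hsigns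
  simp [Finset.sum_add_distrib, hsigns]

theorem re_apply_const_add_re_apply_const_eq_two_pow {W : Type*} [AddCommGroup W] [Module ℂ W]
    {k : ℕ} (hk : k ≠ 0) (G : MultilinearMap ℂ (fun _ : Fin k => W) ℂ) (K : ℂ →ₗ[ℝ] W) {c ζ : ℂ}
    (hG : ∀ v : Fin k → ℂ, (G fun i => K (v i)).re = reForm c v) (hζ : c * ζ ^ k = 1) :
    (G fun _ => K ζ + Complex.I • K (Complex.I * ζ)).re +
      (G fun _ => K ζ - Complex.I • K (Complex.I * ζ)).re = 2 ^ k := by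
  have : NeZero k := ⟨hk⟩
  have hterm : ∀ s : Finset (Fin k),
      (G (s.piecewise (fun _ => K (Complex.I * ζ)) fun _ => K ζ)).re =
        (Complex.I ^ s.card).re := fun s => by
    have hpiecewise : s.piecewise (fun _ => K (Complex.I * ζ)) (fun _ => K ζ) =
        fun i => K ((if i ∈ s then Complex.I else 1) * ζ) := by
      funext i
      by_cases hi : i ∈ s <;> simp [hi]
    rw [hpiecewise, hG, reForm_apply, Finset.prod_mul_distrib, Finset.prod_const,
      Finset.card_univ, Fintype.card_fin, mul_left_comm, hζ, mul_one, Fintype.prod_ite_mem,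
      Finset.prod_const]
  calc _ = ∑ s : Finset (Fin k), 2 * (Complex.I ^ s.card).re ^ 2 := by
        simp only [sub_eq_add_neg, ← neg_smul]
        rw [map_const_add_smul, map_const_add_smul, ← Complex.add_re, ← Finset.sum_add_distrib,
          Complex.re_sum]
        refine Finset.sum_congr rfl fun s _ => ?_
        rw [← add_smul, I_pow_add_neg_I_pow, smul_eq_mul, Complex.re_ofReal_mul, hterm]
        ring
    _ = 2 ^ k := by
        simp only [two_mul_re_I_pow_sq, sum_one_add_neg_one_pow_card, Fintype.card_fin]

variable {H : Type*} [NormedAddCommGroup H] [InnerProductSpace ℝ H]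
  {Ht : Type*} [NormedAddCommGroup Ht] [InnerProductSpace ℂ Ht] {ι : H →ₗ[ℝ] Ht} {k : ℕ}

theorem norm_sq_add_I_smul (hι : IsHilbertComplexification ι) (x y : H) :
    ‖ι x + Complex.I • ι y‖ ^ 2 = ‖x‖ ^ 2 + ‖y‖ ^ 2 := by
  have hlaw := parallelogram_law_with_norm ℂ (ι x) (Complex.I • ι y)
  rw [hι.norm_conj, norm_smul, Complex.norm_I, one_mul, hι.norm_map, hι.norm_map] at hlaw
  linarith

theorem not_forall_re_apply_eq_reForm (hι : IsHilbertComplexification ι) (hk : 3 ≤ k)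
    (J : ℂ →ₗᵢ[ℝ] H) {G : MultilinearMap ℂ (fun _ : Fin k => Ht) ℂ}
    (hdiag : ∀ w, ‖G fun _ => w‖ ≤ ‖w‖ ^ k) {c : ℂ} (hc : ‖c‖ = 1) :
    ¬∀ v : Fin k → ℂ, (G fun i => ι (J (v i))).re = reForm c v := fun hG => by
  obtain ⟨ζ, hζ, hcζ⟩ := exists_norm_eq_one_and_mul_pow_eq_norm c (k := k) (by omega)
  have hvalue := re_apply_const_add_re_apply_const_eq_two_pow (by omega) G (ι ∘ₗ J.toLinearMap)
    hG (hcζ.trans (by rw [hc, Complex.ofReal_one]))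
  set a := ι (J ζ)
  set b := ι (J (Complex.I * ζ))
  have hnorm : ‖a + Complex.I • b‖ ^ 2 = 2 := by
    rw [norm_sq_add_I_smul hι, J.norm_map, J.norm_map, norm_mul, Complex.norm_I, hζ]
    norm_num
  have hbound : (2 : ℝ) ^ k ≤ 2 * ‖a + Complex.I • b‖ ^ k := by
    have hplus := (Complex.re_le_norm _).trans (hdiag (a + Complex.I • b))
    have hminus := (Complex.re_le_norm _).trans (hdiag (a - Complex.I • b))
    rw [hι.norm_conj] at hminus
    exact hvalue.symm.trans_le ((add_le_add hplus hminus).trans_eq (two_mul _).symm)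
  have hsq : ((2 : ℝ) ^ k) ^ 2 ≤ 4 * 2 ^ k :=
    calc ((2 : ℝ) ^ k) ^ 2 ≤ (2 * ‖a + Complex.I • b‖ ^ k) ^ 2 := by gcongr
      _ = 4 * (‖a + Complex.I • b‖ ^ 2) ^ k := by ring
      _ = 4 * 2 ^ k := by rw [hnorm]
  have hpow : (2 : ℝ) ^ 3 ≤ 2 ^ k := pow_le_pow_right₀ one_le_two hk
  nlinarith

theorem re_apply_lt_prod_norm (hι : IsHilbertComplexification ι) (hk : 3 ≤ k) (J : ℂ →ₗᵢ[ℝ] H)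
    {G : MultilinearMap ℂ (fun _ : Fin k => Ht) ℂ} (hG : IsSymmetric G)
    (hdiag : ∀ w, ‖G fun _ => w‖ ≤ ‖w‖ ^ k) {z : Fin k → ℂ} (hz : ∀ i, z i ≠ 0) {i j : Fin k}
    (hij : LinearIndependent ℝ ![z i, z j]) :
    (G fun i => ι (J (z i))).re < ∏ i, ‖z i‖ := by
  let M : MultilinearMap ℝ (fun _ : Fin k => ℂ) ℝ := Complex.reLm.compMultilinearMap
    ((G.restrictScalars ℝ).compLinearMap fun _ => ι ∘ₗ J.toLinearMap)
  have hM : IsSymmetric M := fun σ v => congrArg Complex.re (hG σ fun i => ι (J (v i)))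
  have hle := apply_le_prod_norm hM fun w => (Complex.abs_re_le_norm _).trans
    ((hdiag (ι (J w))).trans_eq (by rw [hι.norm_map, J.norm_map]))
  by_contra! hge
  obtain ⟨c, hc, hMc⟩ := exists_eq_reForm_of_attains hM (N := 1) (by simpa using hle) hz
    (by rw [one_mul]; exact (hle z).antisymm hge) hij
  exact not_forall_re_apply_eq_reForm hι hk J hdiag (hc.trans abs_one) fun v =>
    congrArg (fun f : MultilinearMap ℝ (fun _ : Fin k => ℂ) ℝ => f v) hMc

end Complexification

section Planar

theorem exists_linearIndependent_pair_of_one_lt_finrank_span {K V α : Type*} [DivisionRing K]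
    [AddCommGroup V] [Module K V] {x : α → V}
    (hx : 1 < Module.finrank K (Submodule.span K (Set.range x))) :
    ∃ i j, LinearIndependent K ![x i, x j] := by
  by_contra! hpar
  obtain ⟨i, hi⟩ : ∃ i, x i ≠ 0 := by
    by_contra! hzero
    rw [Submodule.span_eq_bot.mpr (Set.forall_mem_range.mpr hzero), finrank_bot] at hx
    omega
  have hle : Submodule.span K (Set.range x) ≤ Submodule.span K {x i} := by
    rw [Submodule.span_le]
    rintro _ ⟨j, rfl⟩
    rw [SetLike.mem_coe, Submodule.mem_span_singleton]
    simpa [LinearIndependent.pair_iff' hi] using hpar i j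
  exact absurd (Submodule.finrank_mono hle) (by rw [finrank_span_singleton hi]; omega)

variable {H : Type*} [NormedAddCommGroup H] [InnerProductSpace ℝ H] {k : ℕ} {x : Fin k → H}

theorem nonempty_complex_linearIsometryEquiv {F : Type*} [NormedAddCommGroup F]
    [InnerProductSpace ℝ F] (hF : Module.finrank ℝ F = 2) : Nonempty (ℂ ≃ₗᵢ[ℝ] F) :=
  have : FiniteDimensional ℝ F := .of_finrank_eq_succ hF
  ⟨Complex.isometryOfOrthonormal ((stdOrthonormalBasis ℝ F).reindex (finCongr hF))⟩

theorem prod_norm_le_symProjNorm_vee_of_finrank_span_eq_two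
    (hspan : Module.finrank ℝ (Submodule.span ℝ (Set.range x)) = 2) :
    ∏ i, ‖x i‖ ≤ symProjNorm ℝ (vee ℝ x) := by
  set F := Submodule.span ℝ (Set.range x)
  have : FiniteDimensional ℝ F := FiniteDimensional.span_of_finite ℝ (Set.finite_range x)
  obtain ⟨e⟩ := nonempty_complex_linearIsometryEquiv hspan
  have hnorm : ∀ v, ‖e.symm (F.orthogonalProjectionOnto v)‖ ≤ ‖v‖ := fun v =>
    (e.symm.norm_map _).trans_le (F.norm_orthogonalProjectionOnto_apply_le v)
  have hnormx : ∀ i, ‖e.symm (F.orthogonalProjectionOnto (x i))‖ = ‖x i‖ := fun i =>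
    (e.symm.norm_map _).trans
      (F.norm_orthogonalProjectionOnto_apply (Submodule.subset_span (Set.mem_range_self i)))
  refine (Finset.prod_congr rfl fun i _ => (hnormx i).symm).trans_le ?_
  exact prod_norm_le_symProjNorm_vee
    (e.symm.toLinearEquiv.toLinearMap ∘ₗ F.orthogonalProjectionOnto.toLinearMap) hnorm x

theorem symProjNorm_vee_lt_prod_norm_of_finrank_span_eq_two {Ht : Type*} [NormedAddCommGroup Ht]
    [InnerProductSpace ℂ Ht] {ι : H →ₗ[ℝ] Ht} (hι : IsHilbertComplexification ι) (hk : 3 ≤ k)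
    (hx : ∀ i, x i ≠ 0) (hspan : Module.finrank ℝ (Submodule.span ℝ (Set.range x)) = 2) :
    symProjNorm ℂ (vee ℂ fun i => ι (x i)) < ∏ i, ‖x i‖ := by
  obtain ⟨e⟩ := nonempty_complex_linearIsometryEquiv hspan
  let J : ℂ →ₗᵢ[ℝ] H := (Submodule.span ℝ (Set.range x)).subtypeₗᵢ.comp e.toLinearIsometry
  obtain ⟨z, hJz⟩ : ∃ z : Fin k → ℂ, ∀ i, J (z i) = x i :=
    ⟨fun i => e.symm ⟨x i, Submodule.subset_span (Set.mem_range_self i)⟩, by simp [J]⟩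
  have hz : ∀ i, z i ≠ 0 := fun i hi => hx i (by rw [← hJz, hi, map_zero])
  obtain ⟨i, j, hij⟩ : ∃ i j, LinearIndependent ℝ ![x i, x j] :=
    exists_linearIndependent_pair_of_one_lt_finrank_span (one_lt_two.trans_eq hspan.symm)
  have hzij : LinearIndependent ℝ ![z i, z j] := by
    refine LinearIndependent.of_comp J.toLinearMap ?_
    rwa [show J.toLinearMap ∘ ![z i, z j] = ![x i, x j] by
      funext m; fin_cases m <;> exact hJz _]
  obtain ⟨G, hG, hdiag, hGx⟩ := exists_isSymmetric_apply_eq_symProjNorm_vee (𝕜 := ℂ)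
    fun i => ι (x i)
  have hre : (G fun i => ι (x i)).re = symProjNorm ℂ (vee ℂ fun i => ι (x i)) :=
    congrArg Complex.re hGx
  have hlt := re_apply_lt_prod_norm hι hk J hG hdiag hz hzij
  simpa only [← J.norm_map, hJz, hre] using hlt

end Planar

end SymTensor

end

theorem mainTheorem6_general
    {H : Type*} [NormedAddCommGroup H] [InnerProductSpace ℝ H]
    {Ht : Type*} [NormedAddCommGroup Ht] [InnerProductSpace ℂ Ht]
    (ι : H →ₗ[ℝ] Ht) (hι : IsHilbertComplexification ι)
    (k : ℕ) (hk : 3 ≤ k) (x : Fin k → H) (hx : ∀ i, x i ≠ 0)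
    (hspan : Module.finrank ℝ (Submodule.span ℝ (Set.range x)) = 2) :
    SymTensor.symProjNorm ℝ (SymTensor.vee ℝ x) >
      SymTensor.symProjNorm ℂ (SymTensor.vee ℂ (fun i => ι (x i))) :=
  (SymTensor.symProjNorm_vee_lt_prod_norm_of_finrank_span_eq_two hι hk hx hspan).trans_le
    (SymTensor.prod_norm_le_symProjNorm_vee_of_finrank_span_eq_two hspan)

theorem mainTheorem6
    {H : Type*} [NormedAddCommGroup H] [InnerProductSpace ℝ H] [CompleteSpace H]
    {Ht : Type*} [NormedAddCommGroup Ht] [InnerProductSpace ℂ Ht] [CompleteSpace Ht]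
    (ι : H →ₗ[ℝ] Ht) (hι : IsHilbertComplexification ι)
    (k : ℕ) (hk : 3 ≤ k) (x : Fin k → H) (hx : ∀ i, x i ≠ 0)
    (hspan : Module.finrank ℝ (Submodule.span ℝ (Set.range x)) = 2) :
    SymTensor.symProjNorm ℝ (SymTensor.vee ℝ x) >
      SymTensor.symProjNorm ℂ (SymTensor.vee ℂ (fun i => ι (x i))) :=
  mainTheorem6_general ι hι k hk x hx hspan
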